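/- All alphabets are finite. A family of languages $\mathscr{F}$ is \emph{closed under rational transduction} if, whenever $L \subseteq A^*$ belongs to $\mathscr{F}$ and $R \subseteq A^* \times B^*$ is a rational relation (one realised by a finite transducer), the language $\{v \in B^* \mid (u,v) \in R \text{ for some } u \in L\}$ belongs to $\mathscr{F}$. Let $S$ be a semigroup and $\sigma : X^+ \to S$ a finite choice of generators, that is, a surjective morphism from the free semigroup on a finite set $X$. Let $S^1$ be the monoid obtained from $S$ by adjoining a new identity $1$ (even if $S$ already has one), let $\overline{X} = \{\overline{x} \mid x \in X\}$ be a disjoint copy of $X$, and let $\hat{X} = X \cup \overline{X}$. The \emph{loop problem} $L_\sigma(S) \subseteq \hat{X}^*$ is the set of labels of paths from $1$ to $1$ in the directed graph with vertex set $S^1$ having, for all $a \in S^1$ and $x \in X$, an edge labelled $x$ from $a$ to $a(x\sigma)$ and an edge labelled $\overline{x}$ from $a(x\sigma)$ to $a$. We say that $S$ \emph{has loop problem in} $\mathscr{F}$ if $S$ is finitely generated and $L_\sigma(S) \in \mathscr{F}$ for some finite choice of generators $\sigma$ (equivalently for every one, when $\mathscr{F}$ is closed under rational transduction). A semigroup $S$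 with zero is \emph{completely zero-simple} if $S^2 \neq \{0\}$, the only ideals of $S$ are $\{0\}$ and $S$, and $S$ has a primitive idempotent, that is, an idempotent $e \neq 0$ such that every idempotent $f \neq 0$ with $ef = fe = f$ equals $e$. A \emph{maximal subgroup} of $S$ is a subsemigroup which is a group and is maximal under inclusion among such subsemigroups; it is \emph{non-zero} if it is not $\{0\}$. \textbf{Theorem.} Let $\mathscr{F}$ be a family of languages closed under union, rational transduction, product and Kleene closure, and let $S$ be a finitely generated completely zero-simple semigroup. Then the following are equivalent: (i) $S$ has loop problem in $\mathscr{F}$; (ii) some non-zero maximal subgroup of $S$ (regarded as a semigroup) has loop problem in $\mathscr{F}$; (iii) every non-zero maximal subgroup of $S$ (regarded as a semigroup) has loop problem in $\mathscr{F}$. -/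

import Mathlib

/-! ### Loop automata and loop problems -/

/-- The (right) loop automaton of a monoid `M` with respect to `σ : X* → M`. The alphabet is
`X ⊕ X`: the letter `inl x` stands for the generator `x`, the letter `inr x` for its formal
inverse. There is an edge `a → b` labelled `inl x` iff `a * σ x = b`, and an edge `a → b`
labelled `inr x` iff `b * σ x = a`. The state set is `M` and is usually infinite. -/
def loopAutomaton {X M : Type*} [Monoid M] (σ : FreeMonoid X →* M) : NFA (X ⊕ X) M where
  step a s := match s with
    | Sum.inl x => {b | a * σ (FreeMonoid.of x) = b}
    | Sum.inr x => {b | b * σ (FreeMonoid.of x) = a}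
  start := {1}
  accept := {1}

/-- The (right) loop problem of a monoid with respect to `σ`. -/
def monoidLoopProblem {X M : Type*} [Monoid M] (σ : FreeMonoid X →* M) : Language (X ⊕ X) :=
  (loopAutomaton σ).accepts

/-- The extension `X* → S¹` of a morphism `X⁺ → S`. The monoid `S¹ = WithOne S` always has a new
identity, even if `S` already has one. -/
def extendOne {X S : Type*} [Semigroup S] (σ : FreeSemigroup X →ₙ* S) :
    FreeMonoid X →* WithOne S :=
  FreeMonoid.lift fun x => ((σ (FreeSemigroup.of x) : S) : WithOne S)

/-- The loop problem of a semigroup `S` with respect to `σ : X⁺ → S`. -/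
def loopProblem {X S : Type*} [Semigroup S] (σ : FreeSemigroup X →ₙ* S) : Language (X ⊕ X) :=
  monoidLoopProblem (extendOne σ)

/-- `S` admits a finite choice of semigroup generators. -/
def IsFinGenSemigroup (S : Type*) [Semigroup S] : Prop :=
  ∃ (X : Type) (_ : Finite X) (σ : FreeSemigroup X →ₙ* S), Function.Surjective σ

/-! ### Families of languages and rational transductions -/

/-- A finite transducer from `A*` to `B*`: finitely many states and finitely many transitions,
each labelled by a pair of words. -/
structure FinTransducer (A B : Type) where
  State : Type
  finite_state : Finite State
  trans : Set (State × List A × List B × State)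
  finite_trans : trans.Finite
  start : Set State
  accept : Set State

/-- `T.Path p u v q`: there is a path from `p` to `q` labelled `(u, v)`. -/
inductive FinTransducer.Path {A B : Type} (T : FinTransducer A B) :
    T.State → List A → List B → T.State → Prop
  | nil (p : T.State) : Path T p [] [] p
  | cons {p q r : T.State} {u u' : List A} {v v' : List B} :
      (p, u, v, q) ∈ T.trans → Path T q u' v' r → Path T p (u ++ u') (v ++ v') r

/-- The relation between `A*` and `B*` realised by a transducer. -/
def FinTransducer.Rel {A B : Type} (T : FinTransducer A B) (u : List A) (v : List B) : Prop :=
  ∃ p ∈ T.start, ∃ q ∈ T.accept, T.Path p u v q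

/-- The image of a language under the rational transduction realised by `T`. -/
def FinTransducer.image {A B : Type} (T : FinTransducer A B) (L : Language A) : Language B :=
  {v | ∃ u ∈ L, T.Rel u v}

/-- A family of languages: for each alphabet, a set of languages over it. Only finite alphabets
matter below. -/
abbrev LanguageFamily : Type 1 := (A : Type) → Set (Language A)

namespace LanguageFamily

def ClosedUnderUnion (F : LanguageFamily) : Prop :=
  ∀ (A : Type) [Finite A] (L K : Language A), L ∈ F A → K ∈ F A → L + K ∈ F A

def ClosedUnderProduct (F : LanguageFamily) : Prop :=
  ∀ (A : Type) [Finite A] (L K : Language A), L ∈ F A → K ∈ F A → L * K ∈ F A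

def ClosedUnderKleene (F : LanguageFamily) : Prop :=
  ∀ (A : Type) [Finite A] (L : Language A), L ∈ F A → KStar.kstar L ∈ F A

def ClosedUnderTransduction (F : LanguageFamily) : Prop :=
  ∀ (A B : Type) [Finite A] [Finite B] (T : FinTransducer A B) (L : Language A),
    L ∈ F A → T.image L ∈ F B

end LanguageFamily

/-- `S` is finitely generated and has loop problem in `F`, with respect to some finite choice of
generators (equivalently every one, see `HasLoopProblemIn.loopProblem_mem`). -/
def HasLoopProblemIn (F : LanguageFamily) (S : Type*) [Semigroup S] : Prop :=
  ∃ (X : Type) (_ : Finite X) (σ : FreeSemigroup X →ₙ* S),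
    Function.Surjective σ ∧ loopProblem σ ∈ F (X ⊕ X)

/-! ### Completely zero-simple semigroups and maximal subgroups -/

section Semigroups

variable {S : Type*}

/-- A non-empty two-sided ideal. -/
def IsIdealOf [Semigroup S] (I : Set S) : Prop :=
  I.Nonempty ∧ ∀ a ∈ I, ∀ s : S, s * a ∈ I ∧ a * s ∈ I

/-- `S` is zero-simple: `S² ≠ {0}`, and `{0}` and `S` are the only ideals. -/
def IsZeroSimple (S : Type*) [SemigroupWithZero S] : Prop :=
  (∃ a b : S, a * b ≠ 0) ∧ ∀ I : Set S, IsIdealOf I → I = {0} ∨ I = Set.univ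

/-- `e` is a primitive idempotent: minimal among the non-zero idempotents for the order
`f ≤ e ↔ e * f = f ∧ f * e = f`. -/
def IsPrimitiveIdempotent [SemigroupWithZero S] (e : S) : Prop :=
  e ≠ 0 ∧ IsIdempotentElem e ∧
    ∀ f : S, f ≠ 0 → IsIdempotentElem f → e * f = f → f * e = f → f = e

/-- `S` is completely zero-simple: zero-simple with a primitive idempotent. -/
def IsCompletelyZeroSimple (S : Type*) [SemigroupWithZero S] : Prop :=
  IsZeroSimple S ∧ ∃ e : S, IsPrimitiveIdempotent e

/-- The subsemigroup `T` is a group under the multiplication of `S` (its identity need not be an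
identity of `S`). -/
def Subsemigroup.IsGroup [Semigroup S] (T : Subsemigroup S) : Prop :=
  ∃ e ∈ T, (∀ x ∈ T, e * x = x ∧ x * e = x) ∧ ∀ x ∈ T, ∃ y ∈ T, x * y = e ∧ y * x = e

/-- `T` is a maximal subgroup of `S` other than `{0}`. -/
def Subsemigroup.IsNonzeroMaximalSubgroup [SemigroupWithZero S] (T : Subsemigroup S) : Prop :=
  Maximal Subsemigroup.IsGroup T ∧ (T : Set S) ≠ {0}

end Semigroups

/-! ### Independence of the choice of generators -/

section Independence

variable {X Y S : Type*} [Semigroup S]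

/-- The letter `y` is replaced by the word `w y`, its formal inverse by the formal inverse of
`w y`. -/
def hatSubst (w : Y → List X) : Y ⊕ Y → List (X ⊕ X)
  | Sum.inl y => (w y).map Sum.inl
  | Sum.inr y => ((w y).map Sum.inr).reverse

theorem loopAutomaton_evalFrom_pos {M : Type*} [Monoid M] (σ : FreeMonoid X →* M)
    (u : List X) (A : Set M) :
    (loopAutomaton σ).evalFrom A (u.map Sum.inl) =
      {b | ∃ a ∈ A, a * σ (FreeMonoid.ofList u) = b} := by
  induction u generalizing A with
  | nil => ext b; simp
  | cons x u ih =>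
    rw [List.map_cons, NFA.evalFrom_cons, ih]
    ext b
    simp [NFA.mem_stepSet, loopAutomaton, FreeMonoid.ofList_cons, mul_assoc]

theorem loopAutomaton_evalFrom_neg {M : Type*} [Monoid M] (σ : FreeMonoid X →* M)
    (u : List X) (A : Set M) :
    (loopAutomaton σ).evalFrom A ((u.map Sum.inr).reverse) =
      {b | ∃ a ∈ A, b * σ (FreeMonoid.ofList u) = a} := by
  induction u generalizing A with
  | nil => ext b; simp
  | cons x u ih =>
    rw [List.map_cons, List.reverse_cons, NFA.evalFrom_append, ih]
    ext b
    simp [NFA.mem_stepSet, loopAutomaton, FreeMonoid.ofList_cons, mul_assoc]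

theorem loopAutomaton_evalFrom_hatSubst {M : Type*} [Monoid M] (σ : FreeMonoid X →* M)
    (τ : FreeMonoid Y →* M) (w : Y → List X)
    (hw : ∀ y, σ (FreeMonoid.ofList (w y)) = τ (FreeMonoid.of y))
    (v : List (Y ⊕ Y)) (A : Set M) :
    (loopAutomaton σ).evalFrom A (v.flatMap (hatSubst w)) =
      (loopAutomaton τ).evalFrom A v := by
  induction v generalizing A with
  | nil => simp
  | cons s v ih =>
    rw [List.flatMap_cons, NFA.evalFrom_append, NFA.evalFrom_cons, ih]
    congr 1
    cases s with
    | inl y =>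
      rw [hatSubst, loopAutomaton_evalFrom_pos]
      ext b
      simp [NFA.mem_stepSet, loopAutomaton, hw, eq_comm]
    | inr y =>
      rw [hatSubst, loopAutomaton_evalFrom_neg]
      ext b
      simp [NFA.mem_stepSet, loopAutomaton, hw]

/-- The one-state transducer realising the inverse of the free monoid morphism given by `f`. -/
def inverseMorphism {A B : Type} [Finite B] (f : B → List A) : FinTransducer A B where
  State := Unit
  finite_state := inferInstance
  trans := Set.range fun b => ((), f b, [b], ())
  finite_trans := Set.finite_range _
  start := Set.univ
  accept := Set.univ

theorem inverseMorphism_path {A B : Type} [Finite B] (f : B → List A)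
    (p q : (inverseMorphism f).State) (u : List A) (v : List B) :
    (inverseMorphism f).Path p u v q ↔ u = v.flatMap f := by
  constructor
  · intro h
    induction h with
    | nil => rfl
    | cons h _ ih =>
      obtain ⟨b, hb⟩ := h
      simp only at hb
      obtain ⟨-, rfl, rfl, -⟩ := hb
      simp [ih]
  · rintro rfl
    induction v generalizing p with
    | nil => exact FinTransducer.Path.nil _
    | cons b v ih =>
      exact FinTransducer.Path.cons (T := inverseMorphism f) (q := ()) (v := [b])
        ⟨b, rfl⟩ (ih ())

theorem exists_word (σ : FreeSemigroup X →ₙ* S) (hσ : Function.Surjective σ) (s : S) :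
    ∃ w : List X, extendOne σ (FreeMonoid.ofList w) = (s : WithOne S) := by
  obtain ⟨t, rfl⟩ := hσ s
  induction t using FreeSemigroup.recOnMul with
  | ih1 x => exact ⟨[x], by simp [extendOne]⟩
  | ih2 x t h1 h2 =>
    obtain ⟨w1, h1⟩ := h1
    obtain ⟨w2, h2⟩ := h2
    exact ⟨w1 ++ w2, by rw [FreeMonoid.ofList_append, map_mul, h1, h2, map_mul, WithOne.coe_mul]⟩

end Independence

/-- Having loop problem in a family closed under rational transductions does not depend on the
finite choice of generators. -/
theorem HasLoopProblemIn.loopProblem_mem {F : LanguageFamily} (hF : F.ClosedUnderTransduction)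
    {S : Type*} [Semigroup S] (h : HasLoopProblemIn F S) {Y : Type} [Finite Y]
    (τ : FreeSemigroup Y →ₙ* S) : loopProblem τ ∈ F (Y ⊕ Y) := by
  obtain ⟨X, hX, σ, hσ, hL⟩ := h
  choose w hw using fun y => exists_word σ hσ (τ (FreeSemigroup.of y))
  have key : (inverseMorphism (hatSubst w)).image (loopProblem σ) = loopProblem τ := by
    ext v
    have h1 : v ∈ (inverseMorphism (hatSubst w)).image (loopProblem σ) ↔
        v.flatMap (hatSubst w) ∈ loopProblem σ := by
      constructor
      · rintro ⟨u, hu, p, -, q, -, hp⟩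
        rw [inverseMorphism_path] at hp
        exact hp ▸ hu
      · intro hv
        exact ⟨_, hv, (), trivial, (), trivial, (inverseMorphism_path _ _ _ _ _).2 rfl⟩
    rw [h1]
    have h2 := loopAutomaton_evalFrom_hatSubst (extendOne σ) (extendOne τ) w
      (fun y => by rw [hw]; simp [extendOne]) v {1}
    unfold loopProblem monoidLoopProblem
    change (∃ s ∈ ({1} : Set (WithOne S)), s ∈ (loopAutomaton (extendOne σ)).evalFrom {1} _) ↔
      ∃ s ∈ ({1} : Set (WithOne S)), s ∈ (loopAutomaton (extendOne τ)).evalFrom {1} _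
    rw [h2]
  exact key ▸ hF _ _ _ _ hL

/-! The non-zero maximal subgroups of `S` are the non-zero parts `G` of the corners `eSe`, with `e`
a primitive idempotent. Both implications between `S` and `G` pass through the word problem of `G`.

From `S` to `G`: `G` is again finitely generated (`isFinGenSemigroup`). The loop problem of `S` with
respect to generators of `G` is in the family, because independence of generators does not need the
new ones to generate `S`. Its preimage under the morphism `b ↦ y₀ b y₀⁻¹` is the word problem of `G`
(`wordProblem_mem`).

From `G` to `S`: cutting a loop at its visits to the new identity `1` writes the loop problem as the
star of a finite union of languages of paths inside `S` (`loopProblem_eq_kstar`). Such a path may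
pass through `0`. Edges are right multiplications, so left multiplication maps paths to paths; it
can be undone wherever the product is non-zero. Hence, up to left multiplication, there are only
finitely many starting points, and the languages of paths to or from `0` are regular. A path
avoiding `0` is a left translate of a path in `eS \ {0}` (`labelledPath_avoiding_zero_iff`). There
`G` acts freely with finitely many orbits, and a transducer whose states are orbit representatives
produces the path language from the word problem (`pathLanguage_mem_of_mulAction`). -/

/-! ### Paths in labelled graphs -/

section LabelledPath

variable {V V' B : Type*}

/-- `LabelledPath step v w v'`: the labelled graph with edges `step` has a path from `v` to `v'`
labelled `w`. -/
def LabelledPath (step : V → B → V → Prop) : V → List B → V → Prop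
  | v, [], v' => v = v'
  | v, b :: w, v' => ∃ u, step v b u ∧ LabelledPath step u w v'

/-- The set of labels of paths from `v` to `v'`. -/
def pathLanguage (step : V → B → V → Prop) (v v' : V) : Language B :=
  {w | LabelledPath step v w v'}

variable {step : V → B → V → Prop}

theorem mem_pathLanguage {v v' : V} {w : List B} :
    w ∈ pathLanguage step v v' ↔ LabelledPath step v w v' :=
  Iff.rfl

theorem LabelledPath.append_iff {v v' : V} {w w' : List B} :
    LabelledPath step v (w ++ w') v' ↔
      ∃ u, LabelledPath step v w u ∧ LabelledPath step u w' v' := by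
  induction w generalizing v with
  | nil => simp [LabelledPath]
  | cons b w ih =>
    simp only [List.cons_append, LabelledPath, ih]
    constructor
    · rintro ⟨u, hu, t, h1, h2⟩
      exact ⟨t, ⟨u, hu, h1⟩, h2⟩
    · rintro ⟨t, ⟨u, hu, h1⟩, h2⟩
      exact ⟨u, hu, t, h1, h2⟩

theorem LabelledPath.map {step' : V' → B → V' → Prop} {f : V → V'}
    (hf : ∀ v b u, step v b u → step' (f v) b (f u)) {v v' : V} {w : List B}
    (h : LabelledPath step v w v') : LabelledPath step' (f v) w (f v') := by
  induction w generalizing v with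
  | nil => exact congrArg f h
  | cons b w ih =>
    obtain ⟨u, hu, h⟩ := h
    exact ⟨f u, hf _ _ _ hu, ih h⟩

theorem LabelledPath.reverse_iff {v v' : V} {w : List B} :
    LabelledPath (fun v b u => step u b v) v' w.reverse v ↔ LabelledPath step v w v' := by
  induction w generalizing v with
  | nil => exact eq_comm
  | cons b w ih =>
    simp only [List.reverse_cons, LabelledPath.append_iff, ih]
    constructor
    · rintro ⟨u, h, t, ht, rfl⟩
      exact ⟨u, ht, h⟩
    · rintro ⟨u, hu, h⟩
      exact ⟨u, h, v, hu, rfl⟩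

theorem pathLanguage_mul_le (v u v' : V) :
    pathLanguage step v u * pathLanguage step u v' ≤ pathLanguage step v v' := by
  rintro w hw
  obtain ⟨w₁, h₁, w₂, h₂, rfl⟩ := Language.mem_mul.1 hw
  exact LabelledPath.append_iff.2 ⟨u, h₁, h₂⟩

/-- Every path either passes through the vertex `z` or avoids it altogether. -/
theorem LabelledPath.avoids_or_through (z : V) {v v' : V} {w : List B} (hv : v ≠ z)
    (h : LabelledPath step v w v') :
    LabelledPath (fun s b t => step s b t ∧ t ≠ z) v w v' ∨
      w ∈ pathLanguage step v z * pathLanguage step z v' := by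
  induction w generalizing v with
  | nil => exact Or.inl h
  | cons b w ih =>
    obtain ⟨u, hu, h⟩ := h
    by_cases huz : u = z
    · subst huz
      exact Or.inr (Language.mem_mul.2 ⟨[b], ⟨u, hu, rfl⟩, w, h, rfl⟩)
    · rcases ih huz h with h' | h'
      · exact Or.inl ⟨u, ⟨hu, huz⟩, h'⟩
      · obtain ⟨w₁, h₁, w₂, h₂, rfl⟩ := Language.mem_mul.1 h'
        exact Or.inr (Language.mem_mul.2 ⟨b :: w₁, ⟨u, hu, h₁⟩, w₂, h₂, rfl⟩)

/-- If the languages of paths leading to `v'` are finitely many, then they are regular. -/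
theorem isRegular_pathLanguage_of_finite_range (v v' : V)
    (hfin : (Set.range fun u => pathLanguage step u v').Finite) :
    (pathLanguage step v v').IsRegular := by
  apply Language.IsRegular.of_finite_range_leftQuotient
  -- The left quotient by `x` is the union of the path languages from the vertices that `x` reaches;
  -- finitely many languages have finitely many unions.
  refine ((hfin.finite_subsets).image sSup).subset ?_
  rintro _ ⟨x, rfl⟩
  refine ⟨(fun u => pathLanguage step u v') '' {u | LabelledPath step v x u},
    Set.image_subset_range _ _, ?_⟩
  ext y
  rw [sSup_image, Language.mem_leftQuotient, mem_pathLanguage, LabelledPath.append_iff]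
  simp only [Language.mem_iSup, Set.mem_ofPred_eq, mem_pathLanguage, exists_prop]

theorem pathLanguage_eq_reverse (v v' : V) :
    pathLanguage step v v' = (pathLanguage (fun v b u => step u b v) v' v).reverse := by
  ext w
  rw [Language.mem_reverse]
  exact LabelledPath.reverse_iff.symm

/-- The language consisting of the one-letter word `b`. -/
def letterLanguage {B : Type*} (b : B) : Language B :=
  ({[b]} : Set (List B))

theorem isRegular_letterLanguage {B : Type*} (b : B) : (letterLanguage b).IsRegular := by
  have h := isRegular_pathLanguage_of_finite_range
    (step := fun (p : Bool) (c : B) (q : Bool) => p = false ∧ c = b ∧ q = true) false true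
    (Set.toFinite _)
  refine Eq.subst (motive := Language.IsRegular) (Language.ext fun w => ?_) h
  change LabelledPath _ _ w _ ↔ w = [b]
  constructor
  · intro h
    match w, h with
    | [], h => cases h
    | [c], ⟨u, ⟨_, h, _⟩, _⟩ => rw [h]
    | c :: d :: w, ⟨u, ⟨_, _, h⟩, t, ⟨h', _⟩, _⟩ => cases h.symm.trans h'
  · rintro rfl
    exact ⟨true, ⟨rfl, rfl, rfl⟩, rfl⟩

theorem isRegular_zero {B : Type*} : (0 : Language B).IsRegular := by
  apply Language.IsRegular.of_finite_range_leftQuotient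
  refine (Set.finite_singleton (0 : Language B)).subset ?_
  rintro _ ⟨x, rfl⟩
  ext y
  simp [Language.mem_leftQuotient, Language.notMem_zero]

end LabelledPath

/-! ### Closure properties of families of languages -/

namespace LanguageFamily

variable {F : LanguageFamily}

/-- A family closed under rational transductions that contains a language with the empty word
contains every regular language. -/
theorem mem_of_isRegular (hT : F.ClosedUnderTransduction) {A B : Type} [Finite A] [Finite B]
    {L : Language A} (hL : L ∈ F A) (hnil : [] ∈ L) {R : Language B} (hR : R.IsRegular) :
    R ∈ F B := by
  obtain ⟨Q, _, M, rfl⟩ := hR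
  let T : FinTransducer A B :=
    { State := Q
      finite_state := inferInstance
      trans := Set.range fun x : Q × B => (x.1, [], [x.2], M.step x.1 x.2)
      finite_trans := Set.finite_range _
      start := {M.start}
      accept := M.accept }
  have hpath : ∀ {p u v q}, T.Path p u v q → M.evalFrom p v = q := by
    intro p u v q h
    induction h with
    | nil => rfl
    | cons h _ ih =>
      obtain ⟨⟨p, b⟩, hb⟩ := h
      simp only [Prod.mk.injEq] at hb
      obtain ⟨rfl, rfl, rfl, rfl⟩ := hb
      exact ih
  have hpath' : ∀ v p, T.Path p [] v (M.evalFrom p v) := by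
    intro v
    induction v with
    | nil => exact fun p => FinTransducer.Path.nil (T := T) p
    | cons b v ih =>
      exact fun p => FinTransducer.Path.cons (T := T) (u := []) (v := [b]) ⟨(p, b), rfl⟩ (ih _)
  have himage : T.image L = M.accepts := by
    ext v
    constructor
    · rintro ⟨u, -, p, rfl, q, hq, h⟩
      rw [DFA.mem_accepts, DFA.eval, hpath h]
      exact hq
    · exact fun hv => ⟨[], hnil, M.start, rfl, _, hv, hpath' v _⟩
  exact himage ▸ hT A B T L hL

theorem preimage_flatMap_mem (hT : F.ClosedUnderTransduction) {A B : Type} [Finite A] [Finite B]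
    {L : Language A} (hL : L ∈ F A) (f : B → List A) :
    ({w | w.flatMap f ∈ L} : Set (List B)) ∈ F B := by
  have himage : (inverseMorphism f).image L = ({w | w.flatMap f ∈ L} : Set (List B)) := by
    ext v
    constructor
    · rintro ⟨u, hu, p, -, q, -, hp⟩
      rw [inverseMorphism_path] at hp
      subst hp
      exact hu
    · exact fun hv => ⟨_, hv, (), trivial, (), trivial, (inverseMorphism_path _ _ _ _ _).2 rfl⟩
  exact himage ▸ hT A B _ L hL

theorem iSup_mem (hU : F.ClosedUnderUnion) {A : Type} [Finite A] (h0 : (0 : Language A) ∈ F A)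
    {ι : Type*} [Finite ι] {L : ι → Language A} (hL : ∀ i, L i ∈ F A) : (⨆ i, L i) ∈ F A := by
  classical
  have := Fintype.ofFinite ι
  have key : ∀ s : Finset ι, s.sup L ∈ F A := fun s =>
    Finset.sup_induction h0 (fun a ha b hb => hU A a b ha hb) fun i _ => hL i
  simpa [Finset.sup_univ_eq_iSup] using key Finset.univ

/-- Words over `A` are read as elements of the group `G` through `f`, and `G` acts on a labelled
graph with finitely many orbits of vertices, represented by `r`. If the word problem of `G`
belongs to `F`, so does the language of paths between two of the representatives. -/
theorem pathLanguage_mem_of_mulAction_of_rep (hT : F.ClosedUnderTransduction)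
    {A B : Type} [Finite A] [Finite B] {G V : Type*} [Group G] [MulAction G V] {f : A → G}
    (hf : ∀ g, ∃ u : List A, (u.map f).prod = g)
    (hW : ({u | (u.map f).prod = 1} : Set (List A)) ∈ F A)
    {step : V → B → V → Prop} (hstep : ∀ (g : G) v b u, step v b u → step (g • v) b (g • u))
    (hfin : ∀ v b u, {g : G | step v b (g • u)}.Finite)
    (hstab : ∀ v u : V, {g : G | v = g • u}.Finite)
    {Q : Type} [Finite Q] {r : Q → V} (hr : ∀ v, ∃ (g : G) (q : Q), v = g • r q) (p q : Q) :
    pathLanguage step (r p) (r q) ∈ F B := by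
  choose word hword using hf
  -- A vertex `g • r q` is remembered only through `q`; the input word records the group element
  -- relating successive representatives. The transitions without output are needed because two
  -- representatives may lie in one orbit, and they also supply the final group element.
  let T : FinTransducer A B :=
    { State := Q
      finite_state := inferInstance
      trans :=
        (⋃ x : Q × B × Q, (fun g => (x.1, word g, [x.2.1], x.2.2)) ''
          {g : G | step (r x.1) x.2.1 (g • r x.2.2)}) ∪
        (⋃ x : Q × Q, (fun g => (x.1, word g, [], x.2)) '' {g : G | r x.1 = g • r x.2})
      finite_trans :=
        (Set.finite_iUnion fun x => (hfin _ _ _).image _).union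
          (Set.finite_iUnion fun x => (hstab _ _).image _)
      start := {p}
      accept := {q} }
  have hpath : ∀ {p u v q}, T.Path p u v q → LabelledPath step (r p) v ((u.map f).prod • r q) := by
    intro p u v q h
    induction h with
    | nil => exact (one_smul _ _).symm
    | @cons p q t u u' v v' h _ ih =>
      rw [List.map_append, List.prod_append, mul_smul]
      rcases h with h | h
      · obtain ⟨x, g, hg, hx⟩ := Set.mem_iUnion.1 h
        simp only [Prod.mk.injEq] at hx
        obtain ⟨rfl, rfl, rfl, rfl⟩ := hx
        rw [hword]
        exact ⟨_, hg, ih.map (hstep g)⟩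
      · obtain ⟨x, g, hg, hx⟩ := Set.mem_iUnion.1 h
        simp only [Prod.mk.injEq] at hx
        obtain ⟨rfl, rfl, rfl, rfl⟩ := hx
        rw [hword, show r x.1 = g • r x.2 from hg]
        exact ih.map (hstep g)
  have hpath' : ∀ (v : List B) (p q : Q) (g : G), LabelledPath step (r p) v (g • r q) →
      ∃ u, (u.map f).prod = g ∧ T.Path p u v q := by
    intro v
    induction v with
    | nil =>
      intro p q g h
      refine ⟨word g, hword g, ?_⟩
      have h1 : T.Path p (word g ++ []) ([] ++ []) q := FinTransducer.Path.cons
        (Or.inr (Set.mem_iUnion.2 ⟨(p, q), g, h, rfl⟩)) (FinTransducer.Path.nil (T := T) q)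
      simpa using h1
    | cons b v ih =>
      rintro p q g ⟨u, hu, h⟩
      -- The rest of the path is translated by `k⁻¹`, so that it starts at a representative again.
      obtain ⟨k, t, rfl⟩ := hr u
      have h' := h.map (hstep k⁻¹)
      rw [inv_smul_smul, smul_smul] at h'
      obtain ⟨u, hu', hp⟩ := ih _ _ _ h'
      refine ⟨word k ++ u, by simp [hword, hu'], ?_⟩
      exact FinTransducer.Path.cons (T := T) (v := [b])
        (Or.inl (Set.mem_iUnion.2 ⟨(p, b, t), k, hu, rfl⟩)) hp
  have himage : T.image {u | (u.map f).prod = 1} = pathLanguage step (r p) (r q) := by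
    ext v
    constructor
    · rintro ⟨u, hu, p', hp', q', hq', h⟩
      have h' := hpath h
      rwa [show p' = p from hp', show q' = q from hq', show (u.map f).prod = 1 from hu, one_smul] at h'
    · intro h
      obtain ⟨u, hu, hp⟩ := hpath' v p q 1 (by rwa [one_smul])
      exact ⟨u, hu, p, rfl, q, rfl, hp⟩
  exact himage ▸ hT A B T _ hW

/-- As `pathLanguage_mem_of_mulAction_of_rep`, for paths between arbitrary vertices. -/
theorem pathLanguage_mem_of_mulAction (hT : F.ClosedUnderTransduction)
    {A B : Type} [Finite A] [Finite B] {G V : Type*} [Group G] [MulAction G V] {f : A → G}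
    (hf : ∀ g, ∃ u : List A, (u.map f).prod = g)
    (hW : ({u | (u.map f).prod = 1} : Set (List A)) ∈ F A)
    {step : V → B → V → Prop} (hstep : ∀ (g : G) v b u, step v b u → step (g • v) b (g • u))
    (hfin : ∀ v b u, {g : G | step v b (g • u)}.Finite)
    (hstab : ∀ v u : V, {g : G | v = g • u}.Finite)
    {Q : Type} [Finite Q] {r : Q → V} (hr : ∀ v, ∃ (g : G) (q : Q), v = g • r q) (v v' : V) :
    pathLanguage step v v' ∈ F B :=
  pathLanguage_mem_of_mulAction_of_rep hT hf hW hstep hfin hstab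
    -- The two endpoints are adjoined as further representatives; redundancy among representatives
    -- is harmless.
    (r := fun o : Option (Option Q) => o.elim v fun o => o.elim v' r)
    (fun x => let ⟨g, q, h⟩ := hr x; ⟨g, some (some q), h⟩) none (some none)

end LanguageFamily

/-! ### Loop problems as path languages -/

section LoopProblem

variable {X M S : Type*}

/-- The edges of the loop automaton of `M` with respect to the elements `c x`. -/
def mulStep [Mul M] (c : X → M) : M → X ⊕ X → M → Prop
  | a, Sum.inl x, b => a * c x = b
  | a, Sum.inr x, b => b * c x = a

/-- Edges are right multiplications, so left multiplication is a graph endomorphism; this is the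
symmetry behind the regularity and orbit arguments. -/
theorem mulStep.mul_left [Semigroup M] {c : X → M} {a b : M} {s : X ⊕ X} (m : M)
    (h : mulStep c a s b) : mulStep c (m * a) s (m * b) := by
  cases s <;> simp_all [mulStep, mul_assoc]

theorem mulStep.map {N : Type*} [Mul M] [Mul N] (f : M →ₙ* N) {c : X → M} {a b : M} {s : X ⊕ X}
    (h : mulStep c a s b) : mulStep (f ∘ c) (f a) s (f b) := by
  cases s with
  | inl x => exact (map_mul f a (c x)).symm.trans (congrArg f h)
  | inr x => exact (map_mul f b (c x)).symm.trans (congrArg f h)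

theorem mem_loopAutomaton_evalFrom [Monoid M] (σ : FreeMonoid X →* M) (w : List (X ⊕ X))
    (A : Set M) (b : M) :
    b ∈ (loopAutomaton σ).evalFrom A w ↔
      ∃ a ∈ A, LabelledPath (mulStep fun x => σ (FreeMonoid.of x)) a w b := by
  induction w generalizing A with
  | nil => simp [LabelledPath]
  | cons s w ih =>
    rw [NFA.evalFrom_cons, ih]
    simp only [NFA.mem_stepSet, LabelledPath]
    have hs : ∀ a u, u ∈ (loopAutomaton σ).step a s ↔
        mulStep (fun x => σ (FreeMonoid.of x)) a s u := by
      intro a u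
      cases s <;> rfl
    simp only [hs]
    constructor
    · rintro ⟨u, ⟨a, ha, hu⟩, h⟩
      exact ⟨a, ha, u, hu, h⟩
    · rintro ⟨a, ha, u, hu, h⟩
      exact ⟨u, ⟨a, ha, hu⟩, h⟩

theorem loopProblem_eq_pathLanguage [Semigroup S] (σ : FreeSemigroup X →ₙ* S) :
    loopProblem σ =
      pathLanguage (mulStep fun x => ((σ (FreeSemigroup.of x) : S) : WithOne S)) 1 1 := by
  ext w
  have h := mem_loopAutomaton_evalFrom (extendOne σ) w {1} 1
  simp only [Set.mem_singleton_iff, exists_eq_left] at h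
  have h' : w ∈ loopProblem σ ↔ 1 ∈ (loopAutomaton (extendOne σ)).evalFrom {1} w := by
    change (∃ s ∈ ({1} : Set (WithOne S)), s ∈ (loopAutomaton (extendOne σ)).evalFrom {1} w) ↔ _
    simp
  rw [h', h, mem_pathLanguage]
  simp [extendOne]

theorem LabelledPath.coe_withOne [Semigroup S] {c : X → S} {s t : S} {w : List (X ⊕ X)}
    (h : LabelledPath (mulStep c) s w t) :
    LabelledPath (mulStep fun x => (c x : WithOne S)) (s : WithOne S) w t :=
  h.map fun _ _ _ => mulStep.map (WithOne.coeMulHom (α := S))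

/-- A loop at `1` inside `S¹` that returns to `1` only at its end. -/
theorem LabelledPath.cons_append_withOne [Semigroup S] {c : X → S} {x y : X} {w : List (X ⊕ X)}
    (h : LabelledPath (mulStep c) (c x) w (c y)) :
    LabelledPath (mulStep fun x => (c x : WithOne S)) 1 (Sum.inl x :: (w ++ [Sum.inr y])) 1 :=
  ⟨c x, one_mul _, LabelledPath.append_iff.2 ⟨c y, h.coe_withOne, 1, one_mul _, rfl⟩⟩

/-- A path from `S` to `1` decomposes at its first visit to `1`. -/
theorem LabelledPath.exists_first_return [Semigroup S] {c : X → S} {s : S} {w : List (X ⊕ X)}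
    (h : LabelledPath (mulStep fun x => (c x : WithOne S)) (s : WithOne S) w 1) :
    ∃ w₁ y w₂, w = w₁ ++ Sum.inr y :: w₂ ∧ LabelledPath (mulStep c) s w₁ (c y) ∧
      LabelledPath (mulStep fun x => (c x : WithOne S)) 1 w₂ 1 := by
  induction w generalizing s with
  | nil => exact absurd h WithOne.coe_ne_one
  | cons b w ih =>
    obtain ⟨u, hu, h⟩ := h
    induction u using WithOne.recOneCoe with
    | one =>
      cases b with
      | inl x =>
        have hu' : (s : WithOne S) * c x = 1 := hu
        rw [← WithOne.coe_mul] at hu'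
        exact absurd hu' WithOne.coe_ne_one
      | inr y =>
        have hu' : 1 * (c y : WithOne S) = s := hu
        rw [one_mul, WithOne.coe_inj] at hu'
        exact ⟨[], y, w, rfl, hu'.symm, h⟩
    | coe t =>
      obtain ⟨w₁, y, w₂, rfl, h₁, h₂⟩ := ih h
      refine ⟨b :: w₁, y, w₂, rfl, ⟨t, ?_, h₁⟩, h₂⟩
      cases b with
      | inl x => exact WithOne.coe_inj.1 ((WithOne.coe_mul _ _).trans hu)
      | inr x => exact WithOne.coe_inj.1 ((WithOne.coe_mul _ _).trans hu)

/-- A product of elements of `S` is never the adjoined `1`, so a loop leaves `1` only by a letter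
`x` and returns only by a formal inverse, running inside `S` between the two generators. -/
theorem loopProblem_eq_kstar [Semigroup S] (σ : FreeSemigroup X →ₙ* S) :
    loopProblem σ = KStar.kstar (⨆ p : X × X,
      letterLanguage (Sum.inl p.1) *
        pathLanguage (mulStep fun x => σ (FreeSemigroup.of x))
          (σ (FreeSemigroup.of p.1)) (σ (FreeSemigroup.of p.2)) *
        letterLanguage (Sum.inr p.2)) := by
  rw [loopProblem_eq_pathLanguage]
  ext w
  rw [Language.mem_kstar, mem_pathLanguage]
  constructor
  · induction hn : w.length using Nat.strong_induction_on generalizing w with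
    | _ n ih =>
    intro h
    match w, h with
    | [], _ => exact ⟨[], rfl, by simp⟩
    | Sum.inr x :: w, ⟨u, hu, _⟩ =>
      induction u using WithOne.recOneCoe with
      | one =>
        have hu' : (1 : WithOne S) * σ (FreeSemigroup.of x) = 1 := hu
        rw [one_mul] at hu'
        exact absurd hu' WithOne.coe_ne_one
      | coe t =>
        have hu' : (t : WithOne S) * σ (FreeSemigroup.of x) = 1 := hu
        rw [← WithOne.coe_mul] at hu'
        exact absurd hu' WithOne.coe_ne_one
    | Sum.inl x :: w, ⟨u, hu, h⟩ =>
      have hu' : (1 : WithOne S) * σ (FreeSemigroup.of x) = u := hu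
      rw [one_mul] at hu'
      subst hu'
      obtain ⟨w₁, y, w₂, rfl, h₁, h₂⟩ := h.exists_first_return
      obtain ⟨l, rfl, hl⟩ := ih w₂.length (by simp at hn; omega) w₂ rfl h₂
      refine ⟨(Sum.inl x :: (w₁ ++ [Sum.inr y])) :: l, by simp, ?_⟩
      rintro z hz
      rcases List.mem_cons.1 hz with rfl | hz
      · refine Language.mem_iSup.2 ⟨(x, y), Language.mem_mul.2 ⟨Sum.inl x :: w₁, ?_,
          [Sum.inr y], rfl, rfl⟩⟩
        exact Language.mem_mul.2 ⟨[Sum.inl x], rfl, w₁, h₁, rfl⟩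
      · exact hl z hz
  · rintro ⟨l, rfl, hl⟩
    induction l with
    | nil => rfl
    | cons z l ih =>
      rw [List.flatten_cons]
      refine LabelledPath.append_iff.2 ⟨1, ?_, ih fun y hy => hl y (List.mem_cons_of_mem _ hy)⟩
      obtain ⟨⟨x, y⟩, h⟩ := Language.mem_iSup.1 (hl z List.mem_cons_self)
      obtain ⟨_, h₁, _, rfl, rfl⟩ := Language.mem_mul.1 h
      obtain ⟨_, rfl, w, h₂, rfl⟩ := Language.mem_mul.1 h₁
      exact LabelledPath.cons_append_withOne (c := fun x => σ (FreeSemigroup.of x)) h₂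

/-- If the path languages in `S` between generators belong to `F`, so does the loop problem. -/
theorem loopProblem_mem_of_pathLanguage_mem {F : LanguageFamily} (hU : F.ClosedUnderUnion)
    (hT : F.ClosedUnderTransduction) (hP : F.ClosedUnderProduct) (hK : F.ClosedUnderKleene)
    {A X : Type} [Finite A] [Finite X] [Semigroup S] {L : Language A} (hL : L ∈ F A)
    (hnil : [] ∈ L) (σ : FreeSemigroup X →ₙ* S)
    (h : ∀ s t, pathLanguage (mulStep fun x => σ (FreeSemigroup.of x)) s t ∈ F (X ⊕ X)) :
    loopProblem σ ∈ F (X ⊕ X) := by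
  rw [loopProblem_eq_kstar]
  refine hK _ _ (LanguageFamily.iSup_mem hU
    (LanguageFamily.mem_of_isRegular hT hL hnil isRegular_zero) fun p => ?_)
  exact hP _ _ _ (hP _ _ _ (LanguageFamily.mem_of_isRegular hT hL hnil
    (isRegular_letterLanguage _)) (h _ _))
    (LanguageFamily.mem_of_isRegular hT hL hnil (isRegular_letterLanguage _))

end LoopProblem

/-! ### Loop problems of groups -/

section Group

variable {F : LanguageFamily} {G S : Type*} [Group G] [Semigroup S]

/-- The value in `G` of a letter or of its formal inverse. -/
def letterValue {Y : Type*} (c : Y → G) : Y ⊕ Y → G :=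
  Sum.elim c fun y => (c y)⁻¹

/-- In a group, inverse letters act deterministically too, so a word labels exactly one path from
each vertex. -/
theorem LabelledPath.iff_mul_prod {Y : Type*} {c : Y → G} {g h : G} {w : List (Y ⊕ Y)} :
    LabelledPath (mulStep c) g w h ↔ g * (w.map (letterValue c)).prod = h := by
  induction w generalizing g with
  | nil => simp [LabelledPath]
  | cons s w ih =>
    simp only [LabelledPath, ih, List.map_cons, List.prod_cons, ← mul_assoc]
    cases s <;> simp [mulStep, letterValue, eq_mul_inv_iff_mul_eq.symm]

theorem exists_prod_letterValue {Y : Type*} {τ : FreeSemigroup Y →ₙ* G}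
    (hτ : Function.Surjective τ) (g : G) :
    ∃ w : List (Y ⊕ Y), (w.map (letterValue fun y => τ (FreeSemigroup.of y))).prod = g := by
  obtain ⟨t, rfl⟩ := hτ g
  induction t using FreeSemigroup.recOnMul with
  | ih1 y => exact ⟨[Sum.inl y], by simp [letterValue]⟩
  | ih2 y t h₁ h₂ =>
    obtain ⟨w₁, h₁⟩ := h₁
    obtain ⟨w₂, h₂⟩ := h₂
    exact ⟨w₁ ++ w₂, by rw [List.map_append, List.prod_append, h₁, h₂, map_mul]⟩

/-- A path in `S¹` labelled by generators of a subgroup `G` of `S` determines the value of its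
label in `G`, even if it leaves `G`. -/
theorem LabelledPath.mul_prod_eq_mul_one (ι : G →ₙ* S) {Y : Type*} {c : Y → G}
    {a b : WithOne S} {w : List (Y ⊕ Y)}
    (h : LabelledPath (mulStep fun y => ((ι (c y) : S) : WithOne S)) a w b) :
    a * ((ι (w.map (letterValue c)).prod : S) : WithOne S) = b * ((ι 1 : S) : WithOne S) := by
  induction w generalizing a with
  | nil => rw [show a = b from h]; rfl
  | cons s w ih =>
    obtain ⟨u, hu, h⟩ := h
    rw [← ih h]
    cases s with
    | inl y =>
      rw [← show a * ((ι (c y) : S) : WithOne S) = u from hu]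
      simp [letterValue, mul_assoc, ← WithOne.coe_mul, ← map_mul]
    | inr y =>
      rw [← show u * ((ι (c y) : S) : WithOne S) = a from hu]
      simp [letterValue, mul_assoc, ← WithOne.coe_mul, ← map_mul]

/-- If `S` has loop problem in `F` and contains the group `G`, then the word problem of `G` with
respect to any finite family of elements belongs to `F`. -/
theorem HasLoopProblemIn.wordProblem_mem (hT : F.ClosedUnderTransduction)
    (hS : HasLoopProblemIn F S) (ι : G →ₙ* S) (hι : Function.Injective ι)
    {Y : Type} [Finite Y] [Nonempty Y] (τ : FreeSemigroup Y →ₙ* G) :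
    ({w | (w.map (letterValue fun y => τ (FreeSemigroup.of y))).prod = 1} :
      Set (List (Y ⊕ Y))) ∈ F (Y ⊕ Y) := by
  have hL := hS.loopProblem_mem hT (ι.comp τ)
  rw [loopProblem_eq_pathLanguage] at hL
  obtain ⟨y₀⟩ := ‹Nonempty Y›
  set c : Y → G := fun y => τ (FreeSemigroup.of y) with hc
  -- No edge labelled by a formal inverse leaves the adjoined `1`. Sandwiching each letter makes a
  -- non-empty word start with `y₀` and end with its inverse, while its value in `G` is merely
  -- conjugated.
  let f : Y ⊕ Y → List (Y ⊕ Y) := fun b => [Sum.inl y₀, b, Sum.inr y₀]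
  have hprod : ∀ w : List (Y ⊕ Y), ((w.flatMap f).map (letterValue c)).prod =
      c y₀ * (w.map (letterValue c)).prod * (c y₀)⁻¹ := by
    intro w
    induction w with
    | nil => simp
    | cons b w ih =>
      rw [List.flatMap_cons, List.map_append, List.prod_append, ih]
      simp [f, letterValue, mul_assoc]
  have hform : ∀ (b : Y ⊕ Y) (w : List (Y ⊕ Y)), ∃ v,
      (b :: w).flatMap f = Sum.inl y₀ :: (v ++ [Sum.inr y₀]) := by
    intro b w
    induction w generalizing b with
    | nil => exact ⟨[b], rfl⟩
    | cons b' w ih =>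
      obtain ⟨v, hv⟩ := ih b'
      rw [List.flatMap_cons, hv]
      exact ⟨b :: Sum.inr y₀ :: Sum.inl y₀ :: v, rfl⟩
  have hmem := LanguageFamily.preimage_flatMap_mem hT hL f
  convert hmem using 1
  ext w
  change _ = 1 ↔ LabelledPath _ _ _ _
  constructor
  · intro hw
    cases w with
    | nil => rfl
    | cons b w =>
      have hv := hprod (b :: w)
      rw [hw, mul_one, mul_inv_cancel] at hv
      obtain ⟨v, hv'⟩ := hform b w
      rw [hv']
      rw [hv'] at hv
      have hv1 : c y₀ * (v.map (letterValue c)).prod = c y₀ := by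
        simpa [letterValue, ← mul_assoc, mul_inv_eq_one] using hv
      exact LabelledPath.cons_append_withOne (c := ι ∘ c)
        ((LabelledPath.iff_mul_prod.2 hv1).map fun _ _ _ => mulStep.map ι)
  · intro h
    have h1 := LabelledPath.mul_prod_eq_mul_one (c := c) ι h
    rw [one_mul, one_mul, WithOne.coe_inj] at h1
    have h2 := hι h1
    rw [hprod, mul_inv_eq_one, mul_eq_left] at h2
    exact h2

/-- A finitely generated group whose word problem belongs to `F` has loop problem in `F`. -/
theorem hasLoopProblemIn_of_wordProblem_mem (hU : F.ClosedUnderUnion)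
    (hT : F.ClosedUnderTransduction) (hP : F.ClosedUnderProduct) (hK : F.ClosedUnderKleene)
    {Y : Type} [Finite Y] (τ : FreeSemigroup Y →ₙ* G) (hτ : Function.Surjective τ)
    (hW : ({w | (w.map (letterValue fun y => τ (FreeSemigroup.of y))).prod = 1} :
      Set (List (Y ⊕ Y))) ∈ F (Y ⊕ Y)) :
    HasLoopProblemIn F G := by
  refine ⟨Y, ‹_›, τ, hτ, loopProblem_mem_of_pathLanguage_mem hU hT hP hK hW
    (by change _ = _; simp) τ fun s t => ?_⟩
  refine LanguageFamily.pathLanguage_mem_of_mulAction hT (exists_prod_letterValue hτ) hW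
    (fun g v b u h => h.mul_left g) (fun v b u => Set.Subsingleton.finite ?_)
    (fun v u => Set.Subsingleton.finite ?_) (r := fun _ : Unit => (1 : G))
    (fun v => ⟨v, (), (mul_one v).symm⟩) s t
  · intro g hg g' hg'
    cases b with
    | inl y =>
      have h1 : v * _ = g * u := hg
      have h2 : v * _ = g' * u := hg'
      exact mul_right_cancel (h1.symm.trans h2)
    | inr y =>
      have h1 : g * u * _ = v := hg
      have h2 : g' * u * _ = v := hg'
      exact mul_right_cancel (mul_right_cancel (h1.trans h2.symm))
  · intro g hg g' hg'
    exact mul_right_cancel (hg.symm.trans hg')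

end Group

/-! ### Completely zero-simple semigroups -/

section ZeroSimple

variable {S : Type*} [SemigroupWithZero S]

/-- The set `SaS` is an ideal, so it is `S` once it is not `{0}`. The elements annihilated from both
sides form an ideal as well; were `a` among them, this ideal would be `S`, against `S² = S` and `s *
t ≠ 0`. -/
theorem IsZeroSimple.exists_mul_mul_eq (hS : IsZeroSimple S) {a : S} (ha : a ≠ 0) (b : S) :
    ∃ x y, x * a * y = b := by
  obtain ⟨⟨s, t, hst⟩, hI⟩ := hS
  have hsq : ∃ p q, p * q = s := by
    have hideal : IsIdealOf {b | ∃ x y : S, x * y = b} := by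
      refine ⟨⟨_, s, t, rfl⟩, ?_⟩
      rintro _ ⟨x, y, rfl⟩ s
      exact ⟨⟨s, x * y, rfl⟩, ⟨x * y, s, rfl⟩⟩
    rcases hI _ hideal with h | h
    · exact absurd (h.le ⟨s, t, rfl⟩ : s * t = 0) hst
    · exact h.ge (Set.mem_univ s)
  have hann : ∃ x y, x * a * y ≠ 0 := by
    by_contra! hcon
    have hideal : IsIdealOf {c | ∀ x y : S, x * c * y = 0} := by
      refine ⟨⟨0, by simp⟩, fun c hc s => ⟨fun x y => ?_, fun x y => ?_⟩⟩
      · rw [← mul_assoc]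
        exact hc _ _
      · rw [← mul_assoc, mul_assoc]
        exact hc _ _
    rcases hI _ hideal with h | h
    · exact ha (h.le hcon)
    · obtain ⟨p, q, rfl⟩ := hsq
      exact hst ((h.ge (Set.mem_univ q) : ∀ x y : S, x * q * y = 0) p t)
  obtain ⟨x, y, hxy⟩ := hann
  have hideal : IsIdealOf {b | ∃ x y : S, x * a * y = b} := by
    refine ⟨⟨_, x, y, rfl⟩, ?_⟩
    rintro _ ⟨x, y, rfl⟩ s
    exact ⟨⟨s * x, y, by simp only [mul_assoc]⟩, ⟨x, y * s, by simp only [mul_assoc]⟩⟩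
  rcases hI _ hideal with h | h
  · exact absurd (h.le ⟨x, y, rfl⟩ : x * a * y = 0) hxy
  · exact h.ge (Set.mem_univ b)

/-- The non-zero elements of `eSe` are invertible in `eSe` if `e` is a primitive idempotent of a
zero-simple semigroup. -/
theorem IsPrimitiveIdempotent.exists_inverse (hS : IsZeroSimple S) {e : S}
    (he : IsPrimitiveIdempotent e) {a : S} (ha : a ≠ 0) (hea : e * a = a) (hae : a * e = a) :
    ∃ b, e * b = b ∧ b * e = b ∧ a * b = e ∧ b * a = e := by
  obtain ⟨he0, hee, hmin⟩ := he
  have hee : e * e = e := hee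
  obtain ⟨x', y', hxy'⟩ := hS.exists_mul_mul_eq ha e
  obtain ⟨x, hx, hx1, hx2⟩ : ∃ x, x = e * x' * e ∧ e * x = x ∧ x * e = x :=
    ⟨_, rfl, by simp only [← mul_assoc, hee], by simp only [mul_assoc, hee]⟩
  obtain ⟨y, hy, hy1, hy2⟩ : ∃ y, y = e * y' * e ∧ e * y = y ∧ y * e = y :=
    ⟨_, rfl, by simp only [← mul_assoc, hee], by simp only [mul_assoc, hee]⟩
  have hxy : x * a * y = e := by
    calc x * a * y = e * (x' * (e * a * e) * y') * e := by simp only [hx, hy, mul_assoc]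
      _ = e := by rw [hea, hae, hxy', hee, hee]
  -- This is an idempotent below `e`, non-zero since `e = e * e` contains it as a factor;
  -- primitivity makes it `e`. The same holds for `y * x * a`.
  have h1 : a * (y * x) = e := by
    apply hmin
    · intro h
      apply he0
      calc e = x * a * y * (x * a * y) := by rw [hxy, hee]
        _ = x * (a * (y * x)) * a * y := by simp only [mul_assoc]
        _ = 0 := by simp [h]
    · calc a * (y * x) * (a * (y * x)) = a * y * (x * a * y) * x := by simp only [mul_assoc]
        _ = a * (y * x) := by rw [hxy, mul_assoc a, hy2, mul_assoc]
    · rw [← mul_assoc, hea]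
    · rw [mul_assoc, mul_assoc, hx2]
  have h2 : y * x * a = e := by
    apply hmin
    · intro h
      apply he0
      calc e = x * a * y * (x * a * y) := by rw [hxy, hee]
        _ = x * a * (y * x * a) * y := by simp only [mul_assoc]
        _ = 0 := by simp [h]
    · calc y * x * a * (y * x * a) = y * (x * a * y) * x * a := by simp only [mul_assoc]
        _ = y * x * a := by rw [hxy, hy2]
    · rw [← mul_assoc, ← mul_assoc, hy1]
    · rw [mul_assoc, hae]
  exact ⟨y * x, by rw [← mul_assoc, hy1], by rw [mul_assoc, hx2], h1, h2⟩

/-- In a completely zero-simple semigroup every non-zero idempotent is primitive. -/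
theorem IsCompletelyZeroSimple.isPrimitiveIdempotent (hS : IsCompletelyZeroSimple S) {f : S}
    (hf : f ≠ 0) (hff : IsIdempotentElem f) : IsPrimitiveIdempotent f := by
  obtain ⟨hS, e, he0, hee, hmin⟩ := hS
  have hee : e * e = e := hee
  have hff' : f * f = f := hff
  obtain ⟨x', y', hxy'⟩ := hS.exists_mul_mul_eq he0 f
  obtain ⟨x, hx, hx1, hx2⟩ : ∃ x, x = f * x' * e ∧ f * x = x ∧ x * e = x :=
    ⟨_, rfl, by simp only [← mul_assoc, hff'], by simp only [mul_assoc, hee]⟩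
  obtain ⟨y, hy, hy1, hy2⟩ : ∃ y, y = e * y' * f ∧ e * y = y ∧ y * f = y :=
    ⟨_, rfl, by simp only [← mul_assoc, hee], by simp only [mul_assoc, hff']⟩
  have hxy : x * y = f := by
    calc x * y = f * (x' * (e * e) * y') * f := by simp only [hx, hy, mul_assoc]
      _ = f := by rw [hee, hxy', hff', hff']
  refine ⟨hf, hff, fun g hg hgg hfg hgf => ?_⟩
  have hgg' : g * g = g := hgg
  have hxgy : x * (y * g * x) * y = g := by
    calc x * (y * g * x) * y = (x * y) * g * (x * y) := by simp only [mul_assoc]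
      _ = g := by rw [hxy, hfg, hgf]
  -- With `x * y = f`, the map `g ↦ y * g * x` carries idempotents below `f` to idempotents below
  -- `e`, where primitivity is known; `s ↦ x * s * y` carries them back.
  have hygx : y * g * x = e := by
    apply hmin
    · intro h
      rw [h, mul_zero, zero_mul] at hxgy
      exact hg hxgy.symm
    · calc y * g * x * (y * g * x) = y * (g * (x * y) * g) * x := by simp only [mul_assoc]
        _ = y * g * x := by rw [hxy, hgf, hgg']
    · rw [← mul_assoc, ← mul_assoc, hy1]
    · rw [mul_assoc, hx2]
  rw [← hxgy, hygx, hx2, hxy]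

/-- The subsemigroup of the non-zero elements of `eSe`, for a primitive idempotent `e`. -/
def IsPrimitiveIdempotent.corner (hS : IsZeroSimple S) {e : S} (he : IsPrimitiveIdempotent e) :
    Subsemigroup S where
  carrier := {a | a ≠ 0 ∧ e * a = a ∧ a * e = a}
  mul_mem' := by
    rintro a b ⟨ha, ha1, ha2⟩ ⟨hb, hb1, hb2⟩
    refine ⟨fun h => hb ?_, by rw [← mul_assoc, ha1], by rw [mul_assoc, hb2]⟩
    obtain ⟨c, -, -, -, hca⟩ := he.exists_inverse hS ha ha1 ha2
    rw [← hb1, ← hca, mul_assoc, h, mul_zero]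

theorem IsPrimitiveIdempotent.isGroup_corner (hS : IsZeroSimple S) {e : S}
    (he : IsPrimitiveIdempotent e) : (he.corner hS).IsGroup := by
  refine ⟨e, ⟨he.1, he.2.1, he.2.1⟩, fun x hx => hx.2, fun x hx => ?_⟩
  obtain ⟨y, hy1, hy2, hxy, hyx⟩ := he.exists_inverse hS hx.1 hx.2.1 hx.2.2
  refine ⟨y, ⟨fun h => he.1 ?_, hy1, hy2⟩, hxy, hyx⟩
  rw [← hxy, h, mul_zero]

/-- A subgroup with non-zero identity `e` is contained in the non-zero part of `eSe`. -/
theorem Subsemigroup.IsGroup.le_corner (hS : IsZeroSimple S) {T : Subsemigroup S} {e : S}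
    (he : IsPrimitiveIdempotent e) (h1 : ∀ x ∈ T, e * x = x ∧ x * e = x)
    (h2 : ∀ x ∈ T, ∃ y ∈ T, x * y = e ∧ y * x = e) : T ≤ he.corner hS := by
  intro x hx
  refine ⟨?_, h1 x hx⟩
  rintro rfl
  obtain ⟨y, -, hy, -⟩ := h2 _ hx
  exact he.1 (by rw [← hy, zero_mul])

theorem IsPrimitiveIdempotent.isNonzeroMaximalSubgroup_corner (hS : IsZeroSimple S) {e : S}
    (he : IsPrimitiveIdempotent e) : (he.corner hS).IsNonzeroMaximalSubgroup := by
  have hmem : e ∈ he.corner hS := ⟨he.1, he.2.1, he.2.1⟩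
  refine ⟨⟨he.isGroup_corner hS, ?_⟩, fun h => ?_⟩
  · rintro T ⟨f, hf, h1, h2⟩ hle
    have hfe : f = e := by
      obtain ⟨y, -, hy, -⟩ := h2 e (hle hmem)
      have hee : e * e = e := he.2.1
      rw [← hy, ← hee, mul_assoc, hy, (h1 e (hle hmem)).2, hee]
    subst hfe
    exact Subsemigroup.IsGroup.le_corner hS he h1 h2
  · exact he.1 (h.le hmem)

theorem Subsemigroup.IsNonzeroMaximalSubgroup.exists_eq_corner (hS : IsCompletelyZeroSimple S)
    {T : Subsemigroup S} (hT : T.IsNonzeroMaximalSubgroup) :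
    ∃ (e : S) (he : IsPrimitiveIdempotent e), T = he.corner hS.1 := by
  obtain ⟨⟨⟨e, heT, h1, h2⟩, hmax⟩, hne⟩ := hT
  have he0 : e ≠ 0 := by
    rintro rfl
    refine hne (Set.eq_singleton_iff_unique_mem.2 ⟨heT, fun x hx => ?_⟩)
    rw [← (h1 x hx).1, zero_mul]
  have he := hS.isPrimitiveIdempotent he0 (h1 e heT).1
  have hle := Subsemigroup.IsGroup.le_corner hS.1 he h1 h2
  exact ⟨e, he, le_antisymm hle (hmax (he.isGroup_corner hS.1) hle)⟩

/-- A group `G` embedded in `S` as the non-zero part of `eSe` with `e = ι 1`, such that `S` is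
coordinatised by `G`: non-zero elements factor through `e`, and the non-zero elements of `Se` and
of `eS` are invertible on one side. -/
structure IsCornerEmbedding {G : Type*} [Group G] (ι : G →ₙ* S) : Prop where
  injective : Function.Injective ι
  ne_zero : ∀ g, ι g ≠ 0
  exists_eq : ∀ s, s ≠ 0 → ι 1 * s = s → s * ι 1 = s → ∃ g, ι g = s
  exists_factor : ∀ s, s ≠ 0 → ∃ a b, a * ι 1 = a ∧ ι 1 * b = b ∧ s = a * b
  exists_left_inverse : ∀ a, a ≠ 0 → a * ι 1 = a → ∃ a', a' * a = ι 1
  exists_right_inverse : ∀ b, b ≠ 0 → ι 1 * b = b → ∃ b', b' * ι 1 = b' ∧ b * b' = ι 1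

/-- A subsemigroup that is a group, as a group. -/
noncomputable abbrev Subsemigroup.IsGroup.toGroup {T : Subsemigroup S} (hT : T.IsGroup) :
    Group T :=
  { (inferInstance : Semigroup T) with
    one := ⟨hT.choose, hT.choose_spec.1⟩
    one_mul := fun x => Subtype.ext (hT.choose_spec.2.1 x x.2).1
    mul_one := fun x => Subtype.ext (hT.choose_spec.2.1 x x.2).2
    inv := fun x => ⟨(hT.choose_spec.2.2 x x.2).choose, (hT.choose_spec.2.2 x x.2).choose_spec.1⟩
    inv_mul_cancel := fun x => Subtype.ext (hT.choose_spec.2.2 x x.2).choose_spec.2.2 }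

/-- The inclusion of a subsemigroup that is a group. -/
def Subsemigroup.IsGroup.incl {T : Subsemigroup S} (hT : T.IsGroup) :
    letI := hT.toGroup
    T →ₙ* S :=
  letI := hT.toGroup
  { toFun := Subtype.val
    map_mul' := fun _ _ => rfl }

/-- Writing `s = x e y` gives the factorisation `(x e)(e y)`. A non-zero `a ∈ Se` satisfies `x a y =
e` for some `x`, `y`, so `e x a` is a non-zero element of `eSe`, and its inverse there yields a left
inverse of `a`; dually for `eS`. -/
theorem Subsemigroup.IsNonzeroMaximalSubgroup.isCornerEmbedding (hS : IsCompletelyZeroSimple S)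
    {T : Subsemigroup S} (hT : T.IsNonzeroMaximalSubgroup) :
    letI := hT.1.1.toGroup
    IsCornerEmbedding hT.1.1.incl := by
  obtain ⟨e, he, rfl⟩ := hT.exists_eq_corner hS
  let := hT.1.1.toGroup
  have hee : e * e = e := he.2.1
  have hone : hT.1.1.incl 1 = e := by
    have hmem : e ∈ he.corner hS.1 := ⟨he.1, hee, hee⟩
    have h : (⟨e, hmem⟩ : he.corner hS.1) * ⟨e, hmem⟩ = ⟨e, hmem⟩ := Subtype.ext hee
    rw [← mul_eq_left.1 h]
    rfl
  refine ⟨Subtype.val_injective, fun g => g.2.1, ?_, ?_, ?_, ?_⟩ <;> rw [hone]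
  · exact fun s hs h1 h2 => ⟨⟨s, hs, h1, h2⟩, rfl⟩
  · intro s _
    obtain ⟨x, y, rfl⟩ := hS.1.exists_mul_mul_eq he.1 s
    exact ⟨x * e, e * y, by rw [mul_assoc, hee], by rw [← mul_assoc, hee],
      by rw [mul_assoc x e (e * y), ← mul_assoc e e, hee, mul_assoc]⟩
  · intro a ha hae
    obtain ⟨x, y, hxy⟩ := hS.1.exists_mul_mul_eq ha e
    have hxa : e * x * a ≠ 0 := fun h => he.1 (by
      rw [← hee]
      nth_rewrite 2 [← hxy]
      rw [← mul_assoc, ← mul_assoc, h, zero_mul])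
    obtain ⟨c, -, -, -, hc⟩ := he.exists_inverse hS.1 hxa
      (by rw [← mul_assoc, ← mul_assoc, hee]) (by rw [mul_assoc, hae])
    exact ⟨c * (e * x), by rw [mul_assoc, hc]⟩
  · intro b hb heb
    obtain ⟨x, y, hxy⟩ := hS.1.exists_mul_mul_eq hb e
    have hby : b * (y * e) ≠ 0 := fun h => he.1 (by
      rw [← hee]
      nth_rewrite 1 [← hxy]
      rw [mul_assoc, mul_assoc, h, mul_zero])
    obtain ⟨c, -, hce, hc, -⟩ := he.exists_inverse hS.1 hby
      (by rw [← mul_assoc, heb]) (by rw [mul_assoc, mul_assoc, hee])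
    exact ⟨y * e * c, by rw [mul_assoc, hce], by rw [← mul_assoc, hc]⟩

end ZeroSimple

/-! ### Coordinates over the corner group -/

namespace IsCornerEmbedding

variable {S G : Type*} [SemigroupWithZero S] [Group G] {ι : G →ₙ* S}

theorem one_mul_map (ι : G →ₙ* S) (g : G) : ι 1 * ι g = ι g := by
  rw [← map_mul, one_mul]

theorem map_mul_one (ι : G →ₙ* S) (g : G) : ι g * ι 1 = ι g := by
  rw [← map_mul, mul_one]

theorem one_mul_one_mul (ι : G →ₙ* S) (s : S) : ι 1 * (ι 1 * s) = ι 1 * s := by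
  rw [← mul_assoc, one_mul_map]

theorem mul_left_cancel (hι : IsCornerEmbedding ι) {a b c : S} (ha : a ≠ 0) (hae : a * ι 1 = a)
    (hb : ι 1 * b = b) (hc : ι 1 * c = c) (h : a * b = a * c) : b = c := by
  obtain ⟨a', ha'⟩ := hι.exists_left_inverse a ha hae
  rw [← hb, ← hc, ← ha', mul_assoc, mul_assoc, h]

theorem mul_ne_zero (hι : IsCornerEmbedding ι) {a b : S} (ha : a ≠ 0) (hae : a * ι 1 = a)
    (hb : b ≠ 0) (heb : ι 1 * b = b) : a * b ≠ 0 := by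
  obtain ⟨a', ha'⟩ := hι.exists_left_inverse a ha hae
  intro h
  apply hb
  rw [← heb, ← ha', mul_assoc, h, mul_zero]

theorem map_mul_cancel (hι : IsCornerEmbedding ι) {g g' : G} {b : S} (hb : b ≠ 0)
    (heb : ι 1 * b = b) (h : ι g * b = ι g' * b) : g = g' := by
  obtain ⟨b', -, hb'⟩ := hι.exists_right_inverse b hb heb
  apply hι.injective
  rw [← map_mul_one ι g, ← map_mul_one ι g', ← hb', ← mul_assoc, ← mul_assoc, h]

/-- Left multiplication by an element is reversible unless it gives `0`. -/
theorem exists_mul_mul_eq (hι : IsCornerEmbedding ι) {u s : S} (h : u * s ≠ 0) :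
    ∃ m, m * (u * s) = s := by
  have hs : s ≠ 0 := fun hs => h (by rw [hs, mul_zero])
  obtain ⟨a, b, ha, hb, rfl⟩ := hι.exists_factor s hs
  have hua : u * a ≠ 0 := fun hua => h (by rw [← mul_assoc, hua, zero_mul])
  obtain ⟨l, hl⟩ := hι.exists_left_inverse (u * a) hua (by rw [mul_assoc, ha])
  refine ⟨a * l, ?_⟩
  calc a * l * (u * (a * b)) = a * (l * (u * a)) * b := by simp only [mul_assoc]
    _ = a * b := by rw [hl, ha]

/-- If `s * y = a * v ≠ 0` with `a ∈ Se` and `v ∈ eS`, then `s` is a left multiple of `a`. -/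
theorem exists_of_mul_eq (hι : IsCornerEmbedding ι) {a v s y : S} (ha : a ≠ 0)
    (hae : a * ι 1 = a) (hv : v ≠ 0) (hev : ι 1 * v = v) (hs : s ≠ 0) (h : s * y = a * v) :
    ∃ t, t ≠ 0 ∧ ι 1 * t = t ∧ s = a * t ∧ t * y = v := by
  obtain ⟨m, r, hm, hr, rfl⟩ := hι.exists_factor s hs
  obtain ⟨v', hv'e, hv'⟩ := hι.exists_right_inverse v hv hev
  have hmul : m * (r * y * v') = a := by
    calc m * (r * y * v') = m * r * y * v' := by simp only [mul_assoc]
      _ = a := by rw [h, mul_assoc, hv', hae]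
  -- The factorisation `s = m * r` is only determined up to an element of `G`; `g` is the
  -- discrepancy between `m` and `a`.
  obtain ⟨g, hg⟩ := hι.exists_eq (r * y * v') (fun h0 => ha (by rw [← hmul, h0, mul_zero]))
    (by rw [← mul_assoc, ← mul_assoc, hr]) (by rw [mul_assoc, hv'e])
  have het : ι 1 * (ι g⁻¹ * r) = ι g⁻¹ * r := by rw [← mul_assoc, one_mul_map]
  have hs' : m * r = a * (ι g⁻¹ * r) := by
    rw [← hmul, ← hg, mul_assoc m, ← mul_assoc (ι g), ← map_mul, mul_inv_cancel, hr]
  refine ⟨ι g⁻¹ * r, fun h0 => hs (by rw [hs', h0, mul_zero]), het, hs', ?_⟩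
  apply hι.mul_left_cancel ha hae _ hev
  · rw [← mul_assoc, ← h, hs', mul_assoc]
  · rw [← mul_assoc, het]

/-- The corner group of a finitely generated semigroup is finitely generated. -/
theorem isFinGenSemigroup (hι : IsCornerEmbedding ι) (hS : IsFinGenSemigroup S) :
    IsFinGenSemigroup G := by
  obtain ⟨X, _, σ, hσ⟩ := hS
  have hfac : ∀ x, ∃ p : S × S, p.1 * ι 1 = p.1 ∧ ι 1 * p.2 = p.2 ∧
      (σ (FreeSemigroup.of x) ≠ 0 → σ (FreeSemigroup.of x) = p.1 * p.2) := by
    intro x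
    by_cases hx : σ (FreeSemigroup.of x) = 0
    · exact ⟨(0, 0), by simp [hx]⟩
    · obtain ⟨a, b, ha, hb, h⟩ := hι.exists_factor _ hx
      exact ⟨(a, b), ha, hb, fun _ => h⟩
  choose p hpa hpb hp using hfac
  -- With generators factored as `aᵢ bᵢ`, a product is `a₁ (b₁ a₂) ⋯ (bₙ₋₁ aₙ) bₙ`. Multiplying by
  -- `e` on both sides makes every bracket and both ends lie in `eSe`. Those that vanish get the
  -- arbitrary value `1 : G`, as they never occur in a non-zero product.
  let elt : X ⊕ X ⊕ X × X → S :=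
    Sum.elim (fun x => ι 1 * (p x).1) (Sum.elim (fun x => (p x).2 * ι 1)
      fun q => (p q.1).2 * (p q.2).1)
  have helt : ∀ y, ∃ g, elt y ≠ 0 → ι g = elt y := by
    intro y
    by_cases hy : elt y = 0
    · exact ⟨1, fun h => absurd hy h⟩
    · obtain ⟨g, hg⟩ := hι.exists_eq (elt y) hy
        (by rcases y with x | x | x <;> simp [elt, ← mul_assoc, hpb, one_mul_map])
        (by rcases y with x | x | x <;> simp [elt, mul_assoc, hpa, one_mul_map])
      exact ⟨g, fun _ => hg⟩
  choose c hc using helt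
  let τ : FreeSemigroup (X ⊕ X ⊕ X × X) →ₙ* G := FreeSemigroup.lift c
  have hτ : ∀ y, τ (FreeSemigroup.of y) = c y := FreeSemigroup.lift_of c
  have key : ∀ t : FreeSemigroup X, σ t * ι 1 ≠ 0 →
      ∃ x k, σ t * ι 1 = (p x).1 * ι (τ k) := by
    intro t
    induction t using FreeSemigroup.recOnMul with
    | ih1 x =>
      intro h
      have hx := hp x (fun h0 => h (by rw [h0, zero_mul]))
      rw [hx, mul_assoc] at h ⊢
      refine ⟨x, FreeSemigroup.of (Sum.inr (Sum.inl x)), ?_⟩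
      rw [hτ, hc _ fun h0 => h ?_]
      · rfl
      · rw [show (p x).2 * ι 1 = 0 from h0, mul_zero]
    | ih2 x t _ ih =>
      intro h
      rw [map_mul, mul_assoc] at h ⊢
      obtain ⟨y, k, hk⟩ := ih fun h0 => h (by rw [h0, mul_zero])
      have hx := hp x (fun h0 => h (by rw [h0, zero_mul]))
      have heq : σ (FreeSemigroup.of x) * (σ t * ι 1) =
          (p x).1 * ((p x).2 * (p y).1 * ι (τ k)) := by
        rw [hk, hx]
        simp only [mul_assoc]
      rw [heq] at h ⊢
      refine ⟨x, FreeSemigroup.of (Sum.inr (Sum.inr (x, y))) * k, ?_⟩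
      rw [map_mul, map_mul, hτ, hc _ fun h0 => h ?_]
      · rfl
      · rw [show (p x).2 * (p y).1 = 0 from h0, zero_mul, mul_zero]
  refine ⟨X ⊕ X ⊕ X × X, inferInstance, τ, fun g => ?_⟩
  obtain ⟨t, ht⟩ := hσ (ι g)
  have hg0 := hι.ne_zero g
  obtain ⟨x, k, hk⟩ := key t (by rwa [ht, map_mul_one])
  rw [ht, map_mul_one] at hk
  have hg : ι g = ι 1 * (p x).1 * ι (τ k) := by rw [mul_assoc, ← hk, one_mul_map]
  refine ⟨FreeSemigroup.of (Sum.inl x) * k, hι.injective ?_⟩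
  rw [map_mul, map_mul, hτ, hc _ fun h0 => hg0 ?_, hg]
  · rfl
  · rw [hg, show ι 1 * (p x).1 = 0 from h0, zero_mul]

/-! ### Path languages in the semigroup -/

section Paths

variable {F : LanguageFamily} {X A : Type} {σ : FreeSemigroup X →ₙ* S}

theorem exists_generator (hσ : Function.Surjective σ) (s : S) :
    (∃ x, s = σ (FreeSemigroup.of x)) ∨ ∃ u x, s = u * σ (FreeSemigroup.of x) := by
  obtain ⟨t, rfl⟩ := hσ s
  induction t using FreeSemigroup.recOnMul with
  | ih1 x => exact Or.inl ⟨x, rfl⟩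
  | ih2 x t _ ih =>
    rw [map_mul]
    rcases ih with ⟨y, hy⟩ | ⟨u, y, hy⟩
    · exact Or.inr ⟨_, y, by rw [hy]⟩
    · exact Or.inr ⟨σ (FreeSemigroup.of x) * u, y, by rw [hy, mul_assoc]⟩

/-- Up to left multiplication back and forth, there are only finitely many elements of `S`. -/
theorem finite_range_of_mul_left [Finite X] (hι : IsCornerEmbedding ι)
    (hσ : Function.Surjective σ) {α : Type*} [PartialOrder α] {f : S → α}
    (hf : ∀ m s, f s ≤ f (m * s)) : (Set.range f).Finite := by
  refine ((Set.finite_range fun x => f (σ (FreeSemigroup.of x))).union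
    (Set.finite_singleton (f 0))).subset ?_
  rintro _ ⟨s, rfl⟩
  by_cases hs : s = 0
  · exact Or.inr (by rw [hs]; rfl)
  refine Or.inl ?_
  rcases exists_generator hσ s with ⟨x, rfl⟩ | ⟨u, x, rfl⟩
  · exact ⟨x, rfl⟩
  -- A non-zero element and its last generator are left multiples of each other, so monotonicity
  -- gives both inequalities.
  · obtain ⟨m, hm⟩ := hι.exists_mul_mul_eq hs
    refine ⟨x, le_antisymm (hf _ _) ?_⟩
    have h := hf m (u * σ (FreeSemigroup.of x))
    rwa [hm] at h

/-- Since `m * 0 = 0`, left multiplication by `m` sends paths from `s` to `0` to paths from `m * s`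
to `0`; the language is thus monotone in `s` and takes finitely many values. -/
theorem isRegular_pathLanguage_zero_right [Finite X] (hι : IsCornerEmbedding ι)
    (hσ : Function.Surjective σ) (s : S) :
    (pathLanguage (mulStep fun x => σ (FreeSemigroup.of x)) s 0).IsRegular := by
  refine isRegular_pathLanguage_of_finite_range _ _
    (hι.finite_range_of_mul_left hσ fun m s w h => ?_)
  have h' := LabelledPath.map (f := fun t => m * t) (fun _ _ _ => mulStep.mul_left m) h
  rwa [mul_zero] at h'

theorem isRegular_pathLanguage_zero_left [Finite X] (hι : IsCornerEmbedding ι)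
    (hσ : Function.Surjective σ) (s : S) :
    (pathLanguage (mulStep fun x => σ (FreeSemigroup.of x)) 0 s).IsRegular := by
  rw [pathLanguage_eq_reverse]
  refine (isRegular_pathLanguage_of_finite_range _ _
    (hι.finite_range_of_mul_left hσ fun m s w h => ?_)).reverse
  have h' := LabelledPath.map (f := fun t => m * t)
    (step' := fun v b u => mulStep (fun x => σ (FreeSemigroup.of x)) u b v)
    (fun _ _ _ => mulStep.mul_left m) h
  rwa [mul_zero] at h'

/-- The group `G` acts by left multiplication on the non-zero elements of `eS`. -/
abbrev mulAction (hι : IsCornerEmbedding ι) : MulAction G {v : S // v ≠ 0 ∧ ι 1 * v = v} where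
  smul g v := ⟨ι g * v, hι.mul_ne_zero (hι.ne_zero g) (map_mul_one ι g) v.2.1 v.2.2,
    by rw [← mul_assoc, one_mul_map]⟩
  one_smul v := Subtype.ext v.2.2
  mul_smul g h v := Subtype.ext ((congrArg (· * v.1) (map_mul ι g h)).trans (mul_assoc _ _ _))

/-- Paths inside the non-zero part of `eS`. -/
theorem pathLanguage_corner_mem [Finite X] [Finite A] (hι : IsCornerEmbedding ι)
    (hT : F.ClosedUnderTransduction) (hσ : Function.Surjective σ) {f : A → G}
    (hf : ∀ g, ∃ u : List A, (u.map f).prod = g)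
    (hW : ({u | (u.map f).prod = 1} : Set (List A)) ∈ F A)
    (v v' : {v : S // v ≠ 0 ∧ ι 1 * v = v}) :
    pathLanguage (fun (a : {v : S // v ≠ 0 ∧ ι 1 * v = v}) (b : X ⊕ X)
      (a' : {v : S // v ≠ 0 ∧ ι 1 * v = v}) =>
        mulStep (fun x => σ (FreeSemigroup.of x)) a.1 b a'.1) v v' ∈ F (X ⊕ X) := by
  let := hι.mulAction
  have hfac : ∀ x : {x // σ (FreeSemigroup.of x) ≠ 0}, ∃ (a : S)
      (b : {v : S // v ≠ 0 ∧ ι 1 * v = v}), a * ι 1 = a ∧ σ (FreeSemigroup.of x.1) = a * b := by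
    intro x
    obtain ⟨a, b, ha, hb, h⟩ := hι.exists_factor _ x.2
    exact ⟨a, ⟨b, fun h0 => x.2 (by rw [h, h0, mul_zero]), hb⟩, ha, h⟩
  choose a r ha hr using hfac
  refine LanguageFamily.pathLanguage_mem_of_mulAction hT hf hW
    (fun g v b u h => mulStep.mul_left (ι g) h) (fun v b u => Set.Subsingleton.finite ?_)
    (fun v u => Set.Subsingleton.finite ?_) (r := r) (fun v => ?_) v v'
  · intro g hg g' hg'
    cases b with
    | inl y =>
      have h1 : v.1 * _ = ι g * u.1 := hg
      have h2 : v.1 * _ = ι g' * u.1 := hg'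
      exact hι.map_mul_cancel u.2.1 u.2.2 (h1.symm.trans h2)
    | inr y =>
      have h1 : ι g * u.1 * _ = v := hg
      have h2 : ι g' * u.1 * _ = v := hg'
      rw [mul_assoc] at h1 h2
      refine hι.map_mul_cancel (fun h0 => v.2.1 ?_) ?_ (h1.trans h2.symm)
      · rw [← h1, h0, mul_zero]
      · rw [← mul_assoc, u.2.2]
  · intro g hg g' hg'
    exact hι.map_mul_cancel u.2.1 u.2.2 (congrArg Subtype.val (hg.symm.trans hg'))
  -- The right factors of the non-zero generators represent all orbits: splitting off the last
  -- generator gives `v = (u * a) * r` with `u * a` in the corner group.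
  · obtain ⟨u, x, hu, hv⟩ : ∃ u x, ι 1 * u = u ∧ v.1 = u * σ (FreeSemigroup.of x) := by
      rcases exists_generator hσ v.1 with ⟨x, hx⟩ | ⟨u, x, hx⟩
      · exact ⟨ι 1, x, one_mul_map ι 1, by rw [← hx, v.2.2]⟩
      · exact ⟨ι 1 * u, x, one_mul_one_mul ι u, by rw [mul_assoc, ← hx, v.2.2]⟩
    have hx : σ (FreeSemigroup.of x) ≠ 0 := fun h0 => v.2.1 (by rw [hv, h0, mul_zero])
    rw [hr ⟨x, hx⟩, ← mul_assoc] at hv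
    obtain ⟨g, hg⟩ := hι.exists_eq (u * a ⟨x, hx⟩)
      (fun h0 => v.2.1 (by rw [hv, h0, zero_mul])) (by rw [← mul_assoc, hu])
      (by rw [mul_assoc, ha])
    exact ⟨g, ⟨x, hx⟩, Subtype.ext (by rw [hv, ← hg]; rfl)⟩

/-- A path in `S` starting at `a * v`, with `a ∈ Se` and `v ∈ eS`, and avoiding `0` is the
translate by `a` of a path in `eS`. -/
theorem labelledPath_avoiding_zero_iff (hι : IsCornerEmbedding ι) {c : X → S} {a : S}
    (ha : a ≠ 0) (hae : a * ι 1 = a) (v : {v : S // v ≠ 0 ∧ ι 1 * v = v}) (t : S)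
    (w : List (X ⊕ X)) :
    LabelledPath (fun s b t => mulStep c s b t ∧ t ≠ 0) (a * v) w t ↔
      ∃ v' : {v : S // v ≠ 0 ∧ ι 1 * v = v}, t = a * v' ∧
        LabelledPath (fun (s : {v : S // v ≠ 0 ∧ ι 1 * v = v}) (b : X ⊕ X)
          (s' : {v : S // v ≠ 0 ∧ ι 1 * v = v}) => mulStep c s.1 b s'.1) v w v' := by
  constructor
  · intro h
    induction w generalizing v with
    | nil => exact ⟨v, Eq.symm h, rfl⟩
    | cons b w ih =>
      obtain ⟨s, ⟨hs, hs0⟩, h⟩ := h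
      cases b with
      | inl y =>
        have hs : a * v.1 * c y = s := hs
        rw [mul_assoc] at hs
        subst hs
        let u : {v : S // v ≠ 0 ∧ ι 1 * v = v} :=
          ⟨v.1 * c y, fun h0 => hs0 (by rw [h0, mul_zero]), by rw [← mul_assoc, v.2.2]⟩
        have hu : mulStep c v.1 (Sum.inl y) u.1 := rfl
        obtain ⟨v', ht, hp⟩ := ih u h
        exact ⟨v', ht, u, hu, hp⟩
      | inr y =>
        -- An inverse letter chooses any `s` with `s * c y = a * v`; such an `s` cannot leave `a *
        -- eS`.
        obtain ⟨u, hu0, hu, rfl, huv⟩ := hι.exists_of_mul_eq ha hae v.2.1 v.2.2 hs0 hs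
        obtain ⟨v', ht, hp⟩ := ih ⟨u, hu0, hu⟩ h
        exact ⟨v', ht, ⟨u, hu0, hu⟩, huv, hp⟩
  · rintro ⟨v', rfl, hp⟩
    exact LabelledPath.map (f := fun u : {v : S // v ≠ 0 ∧ ι 1 * v = v} => a * u.1)
      (step' := fun s b t => mulStep c s b t ∧ t ≠ 0) (fun _ _ u h =>
      ⟨mulStep.mul_left a h, hι.mul_ne_zero ha hae u.2.1 u.2.2⟩) hp

theorem pathLanguage_mem [Finite X] [Finite A] (hι : IsCornerEmbedding ι)
    (hU : F.ClosedUnderUnion) (hT : F.ClosedUnderTransduction) (hP : F.ClosedUnderProduct)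
    (hσ : Function.Surjective σ) {f : A → G} (hf : ∀ g, ∃ u : List A, (u.map f).prod = g)
    (hW : ({u | (u.map f).prod = 1} : Set (List A)) ∈ F A) (s t : S) :
    pathLanguage (mulStep fun x => σ (FreeSemigroup.of x)) s t ∈ F (X ⊕ X) := by
  have hreg : ∀ {R : Language (X ⊕ X)}, R.IsRegular → R ∈ F (X ⊕ X) :=
    LanguageFamily.mem_of_isRegular hT hW (by change _ = _; simp)
  by_cases hs : s = 0
  · subst hs
    exact hreg (hι.isRegular_pathLanguage_zero_left hσ t)
  have hsplit : pathLanguage (mulStep fun x => σ (FreeSemigroup.of x)) s t =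
      pathLanguage (fun s b t => mulStep (fun x => σ (FreeSemigroup.of x)) s b t ∧ t ≠ 0) s t +
        pathLanguage (mulStep fun x => σ (FreeSemigroup.of x)) s 0 *
          pathLanguage (mulStep fun x => σ (FreeSemigroup.of x)) 0 t := by
    ext w
    rw [Language.mem_add]
    constructor
    · exact fun h => LabelledPath.avoids_or_through 0 hs h
    · rintro (h | h)
      · exact LabelledPath.map (f := id) (fun _ _ _ h => h.1) h
      · exact pathLanguage_mul_le _ _ _ h
  rw [hsplit]
  refine hU _ _ _ ?_ (hP _ _ _ (hreg (hι.isRegular_pathLanguage_zero_right hσ s))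
    (hreg (hι.isRegular_pathLanguage_zero_left hσ t)))
  obtain ⟨a, b, hae, heb, rfl⟩ := hι.exists_factor s hs
  have ha : a ≠ 0 := fun h0 => hs (by rw [h0, zero_mul])
  have hb : b ≠ 0 := fun h0 => hs (by rw [h0, mul_zero])
  have hiff := hι.labelledPath_avoiding_zero_iff (c := fun x => σ (FreeSemigroup.of x)) ha hae
    ⟨b, hb, heb⟩ t
  -- Off `a * eS` no path avoiding `0` ends; on it the endpoint `v'` is unique, by left cancellation
  -- of `a`.
  by_cases ht : ∃ v' : {v : S // v ≠ 0 ∧ ι 1 * v = v}, t = a * v'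
  · obtain ⟨v', rfl⟩ := ht
    refine Eq.subst (motive := (· ∈ F (X ⊕ X))) (Language.ext fun w => ?_)
      (hι.pathLanguage_corner_mem hT hσ hf hW ⟨b, hb, heb⟩ v')
    refine Iff.trans ?_ (hiff w).symm
    constructor
    · exact fun h => ⟨v', rfl, h⟩
    · rintro ⟨u, hu, h⟩
      rwa [← Subtype.ext (hι.mul_left_cancel ha hae v'.2.2 u.2.2 hu)] at h
  · refine Eq.subst (motive := (· ∈ F (X ⊕ X))) (Language.ext fun w => ?_) (hreg isRegular_zero)
    refine iff_of_false (Language.notMem_zero w) fun h => ?_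
    obtain ⟨v', hv', -⟩ := (hiff w).1 h
    exact ht ⟨v', hv'⟩

end Paths

variable {F : LanguageFamily}

/-- If the corner group has loop problem in `F`, so does the whole semigroup. -/
theorem hasLoopProblemIn (hι : IsCornerEmbedding ι) (hU : F.ClosedUnderUnion)
    (hT : F.ClosedUnderTransduction) (hP : F.ClosedUnderProduct) (hK : F.ClosedUnderKleene)
    (hS : IsFinGenSemigroup S) (hG : HasLoopProblemIn F G) : HasLoopProblemIn F S := by
  obtain ⟨X, _, σ, hσ⟩ := hS
  obtain ⟨Y, _, τ, hτ, -⟩ := id hG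
  have : Nonempty Y := (hτ 1).elim fun t _ => ⟨t.head⟩
  have hW := hG.wordProblem_mem hT (MulHom.id G) Function.injective_id τ
  exact ⟨X, ‹_›, σ, hσ, loopProblem_mem_of_pathLanguage_mem hU hT hP hK hW
    (by change _ = _; simp) σ
    (hι.pathLanguage_mem hU hT hP hσ (exists_prod_letterValue hτ) hW)⟩

/-- If the whole semigroup has loop problem in `F`, so does the corner group. -/
theorem hasLoopProblemIn_group (hι : IsCornerEmbedding ι) (hU : F.ClosedUnderUnion)
    (hT : F.ClosedUnderTransduction) (hP : F.ClosedUnderProduct) (hK : F.ClosedUnderKleene)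
    (hfg : IsFinGenSemigroup S) (hS : HasLoopProblemIn F S) : HasLoopProblemIn F G := by
  obtain ⟨Y, _, τ, hτ⟩ := hι.isFinGenSemigroup hfg
  have : Nonempty Y := (hτ 1).elim fun t _ => ⟨t.head⟩
  exact hasLoopProblemIn_of_wordProblem_mem hU hT hP hK τ hτ
    (hS.wordProblem_mem hT ι hι.injective τ)

end IsCornerEmbedding

theorem mainTheorem2 (F : LanguageFamily)
    (hUnion : F.ClosedUnderUnion) (hTransduction : F.ClosedUnderTransduction)
    (hProduct : F.ClosedUnderProduct) (hKleene : F.ClosedUnderKleene)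
    {S : Type*} [SemigroupWithZero S] (hfg : IsFinGenSemigroup S)
    (hS : IsCompletelyZeroSimple S) :
    List.TFAE [
      HasLoopProblemIn F S,
      ∃ T : Subsemigroup S, T.IsNonzeroMaximalSubgroup ∧ HasLoopProblemIn F T,
      ∀ T : Subsemigroup S, T.IsNonzeroMaximalSubgroup → HasLoopProblemIn F T] := by
  tfae_have 1 → 3 := by
    intro h T hT
    let := hT.1.1.toGroup
    exact (hT.isCornerEmbedding hS).hasLoopProblemIn_group hUnion hTransduction hProduct hKleene
      hfg h
  tfae_have 3 → 2 := by
    intro h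
    obtain ⟨e, he⟩ := hS.2
    exact ⟨_, he.isNonzeroMaximalSubgroup_corner hS.1,
      h _ (he.isNonzeroMaximalSubgroup_corner hS.1)⟩
  tfae_have 2 → 1 := by
    rintro ⟨T, hT, h⟩
    let := hT.1.1.toGroup
    exact (hT.isCornerEmbedding hS).hasLoopProblemIn hUnion hTransduction hProduct hKleene hfg h
  tfae_finish
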